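/- Let $\mathbb D$ be the open unit disc in $\mathbb C$, and let $A_{\mathbb R}(\mathbb D)$ be the real disc algebra: the ring, under pointwise operations, of all continuous functions $f:\overline{\mathbb D}\to\mathbb C$ that are holomorphic in $\mathbb D$ and satisfy $f(z)=\overline{f(\overline z)}$ for all $z\in\overline{\mathbb D}$. A pair $(f,g)$ of elements of $A_{\mathbb R}(\mathbb D)$ is called invertible if there are $a,b\in A_{\mathbb R}(\mathbb D)$ with $af+bg=1$. Let $(f_1,g_1)$ and $(f_2,g_2)$ be invertible pairs in $A_{\mathbb R}(\mathbb D)$. They are called simultaneously stabilizable if there exist $\alpha,\beta\in A_{\mathbb R}(\mathbb D)$ such that $\alpha f_1+\beta g_1$ and $\alpha f_2+\beta g_2$ are both invertible elements of the ring $A_{\mathbb R}(\mathbb D)$. At every $x\in[-1,1]$ with $(f_1g_2-f_2g_1)(x)=0$ there is a unique real number $\lambda(x)$, necessarily nonzero, with $(f_2(x),g_2(x))=\lambda(x)\,(f_1(x),g_1(x))$; the two pairs are called sign-linked if $\lambda(x)$ has the same sign at all such $x$ (in particular, if there is no such $x$). Theorem. The invertible pairs $(f_1,g_1)$ and $(f_2,g_2)$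 are simultaneously stabilizable if and only if they are sign-linked. -/

import Mathlib

open Metric

/-- A pair `(f, g)` in a commutative ring is invertible if `a f + b g = 1` for some `a, b`. -/
def IsInvertiblePair {R : Type*} [CommRing R] (p : R × R) : Prop :=
  ∃ a b : R, a * p.1 + b * p.2 = 1

/-- Two pairs are simultaneously stabilizable if one and the same pair `(α, β)` makes both
`α f₁ + β g₁` and `α f₂ + β g₂` invertible in the ring. -/
def SimultaneouslyStabilizable {R : Type*} [CommRing R] (p q : R × R) : Prop :=
  ∃ α β : R, IsUnit (α * p.1 + β * p.2) ∧ IsUnit (α * q.1 + β * q.2)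

/-- The closed unit disc of the complex plane. -/
abbrev ClosedDisc : Type := closedBall (0 : ℂ) 1

/-- Complex conjugation on the closed unit disc. -/
def ClosedDisc.conj (z : ClosedDisc) : ClosedDisc :=
  ⟨(starRingEnd ℂ) (z : ℂ), by
    rw [mem_closedBall_zero_iff, RCLike.norm_conj]
    exact mem_closedBall_zero_iff.mp z.2⟩

/-- A real number in `[-1, 1]`, as a point of the closed unit disc. -/
def ClosedDisc.ofReal (x : Set.Icc (-1 : ℝ) 1) : ClosedDisc :=
  ⟨((x : ℝ) : ℂ), by simpa using abs_le.mpr x.2⟩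

/-- The real disc algebra: continuous functions on the closed unit disc that are holomorphic on
the open unit disc and satisfy `f z = conj (f (conj z))` for all `z` in the closed disc, with
pointwise operations. -/
def RealDiscAlgebra : Subalgebra ℝ C(ClosedDisc, ℂ) where
  carrier := {f | (∃ F : ℂ → ℂ, DifferentiableOn ℂ F (ball 0 1) ∧ ∀ z : ClosedDisc, F z = f z) ∧
    ∀ z : ClosedDisc, f z = (starRingEnd ℂ) (f z.conj)}
  mul_mem' := by
    rintro f g ⟨⟨F, hF, hFf⟩, hf⟩ ⟨⟨G, hG, hGg⟩, hg⟩
    refine ⟨⟨fun z => F z * G z, hF.mul hG, fun z => ?_⟩, fun z => ?_⟩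
    · simp [hFf, hGg]
    · rw [ContinuousMap.mul_apply, ContinuousMap.mul_apply, map_mul, ← hf z, ← hg z]
  add_mem' := by
    rintro f g ⟨⟨F, hF, hFf⟩, hf⟩ ⟨⟨G, hG, hGg⟩, hg⟩
    refine ⟨⟨fun z => F z + G z, hF.add hG, fun z => ?_⟩, fun z => ?_⟩
    · simp [hFf, hGg]
    · rw [ContinuousMap.add_apply, ContinuousMap.add_apply, map_add, ← hf z, ← hg z]
  algebraMap_mem' := by
    intro r
    refine ⟨⟨fun _ => (r : ℂ), differentiableOn_const _, fun z => ?_⟩, fun z => ?_⟩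
    · simp [algebraMap_apply]
    · simp [algebraMap_apply]

/-- The pairs `p = (f₁, g₁)` and `q = (f₂, g₂)` are sign-linked: on the set of those `x ∈ [-1, 1]`
where `f₁ g₂ - f₂ g₁` vanishes, the real factor `λ(x)` with
`(f₂ x, g₂ x) = λ(x) (f₁ x, g₁ x)` has one and the same sign. -/
def SignLinked (p q : RealDiscAlgebra × RealDiscAlgebra) : Prop :=
  ∀ (x y : Set.Icc (-1 : ℝ) 1) (s t : ℝ),
    (p.1 * q.2 - q.1 * p.2).1 (ClosedDisc.ofReal x) = 0 →
    (p.1 * q.2 - q.1 * p.2).1 (ClosedDisc.ofReal y) = 0 →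
    q.1.1 (ClosedDisc.ofReal x) = s * p.1.1 (ClosedDisc.ofReal x) →
    q.2.1 (ClosedDisc.ofReal x) = s * p.2.1 (ClosedDisc.ofReal x) →
    q.1.1 (ClosedDisc.ofReal y) = t * p.1.1 (ClosedDisc.ofReal y) →
    q.2.1 (ClosedDisc.ofReal y) = t * p.2.1 (ClosedDisc.ofReal y) →
    SignType.sign s = SignType.sign t

/-!
After division by the unit `α f₁ + β g₁` one may assume `α f₁ + β g₁ = 1`. If `a f₁ + b g₁ = 1`, the
solutions are `(α, β) = (a + h g₁, b - h f₁)`, and then `α f₂ + β g₂ = F + h D` with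
`F = a f₂ + b g₂` and `D = f₂ g₁ - f₁ g₂`. So the pairs are simultaneously stabilizable iff some
`F + h D` is a unit, and at a zero of `D` in `[-1, 1]` the value of `F` is the factor `λ`.
Units are the functions without zeros on the closed disc, hence have constant sign on `[-1, 1]`;
this gives necessity. Sufficiency is the statement that an invertible pair `(f, g)` such that `f`
has constant sign on the zeros of `g` in `[-1, 1]` admits `h` with `f + h g` a unit
(`RealDiscAlgebra.unitModulo_of_mul_pos`).

The argument for the latter is a homotopy argument. If `x f + y g = 1` and `f'` is close to `f`,
then `f' ≡ f v` modulo `g` for the unit `v = 1 + x (f' - f)`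
(`RealDiscAlgebra.eventually_eq_mul_add`). Hence the property "some `f + h g` is a unit" is locally
constant on the set of `f` for which `(f, g)` is invertible
(`RealDiscAlgebra.UnitModulo.of_isPreconnected`), and it is multiplicative. As polynomials are
dense, `f` may be taken to be a real polynomial, whose roots can be moved as long as they avoid the
zeros of `g`. The zero set of `g ≠ 0` does not separate the plane
(`RealDiscAlgebra.isPreconnected_nonzeroSet`): it is countable inside the open disc, and does not
contain the whole circle. So a pair of conjugate roots, or a double real root, can be moved out of
the disc, where the factor becomes a unit. A real root with no zero of `g` on one side leaves the
disc along the real line, and two real roots with no zero of `g` between them can be merged into a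
double root. The sign condition ensures that these moves remove all roots
(`RealDiscAlgebra.unitModulo_ofPoly`). That `(P, g)` is invertible when `P` is a linear or conjugate
quadratic factor whose roots are not zeros of `g` is shown by approximating `g` by polynomials, so
no corona theorem is needed.
-/

open Polynomial Filter Topology

namespace RealDiscAlgebra

/-! ### Evaluation and units -/

-- The two instances shorten slow searches through the subalgebra.
noncomputable instance : NormedAlgebra ℝ RealDiscAlgebra :=
  Subalgebra.toNormedAlgebra RealDiscAlgebra

noncomputable instance : NormedSpace ℝ RealDiscAlgebra := NormedAlgebra.toNormedSpace _

/-- Evaluation at a point of the closed disc, as a homomorphism of real algebras. -/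
noncomputable def evalAt (z : ClosedDisc) : RealDiscAlgebra →ₐ[ℝ] ℂ :=
  (ContinuousMap.evalAlgHom ℝ ℂ z).comp RealDiscAlgebra.val

theorem evalAt_apply (z : ClosedDisc) (f : RealDiscAlgebra) : evalAt z f = f.1 z := rfl

theorem evalAt_add (z : ClosedDisc) (f g : RealDiscAlgebra) :
    evalAt z (f + g) = evalAt z f + evalAt z g := rfl

theorem evalAt_sub (z : ClosedDisc) (f g : RealDiscAlgebra) :
    evalAt z (f - g) = evalAt z f - evalAt z g := rfl

theorem evalAt_mul (z : ClosedDisc) (f g : RealDiscAlgebra) :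
    evalAt z (f * g) = evalAt z f * evalAt z g := rfl

theorem evalAt_one (z : ClosedDisc) : evalAt z 1 = 1 := rfl

theorem norm_evalAt_le (z : ClosedDisc) (f : RealDiscAlgebra) : ‖evalAt z f‖ ≤ ‖f‖ :=
  f.1.norm_coe_le_norm z

theorem continuous_evalAt (f : RealDiscAlgebra) : Continuous fun z => evalAt z f :=
  f.1.continuous

theorem ext_evalAt {f g : RealDiscAlgebra} (h : ∀ z, evalAt z f = evalAt z g) : f = g :=
  Subtype.ext (ContinuousMap.ext h)

theorem norm_lt_of_forall_evalAt {f : RealDiscAlgebra} {c : ℝ} (hc : 0 < c)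
    (h : ∀ z, ‖evalAt z f‖ < c) : ‖f‖ < c :=
  (ContinuousMap.norm_lt_iff f.1 hc).2 h

theorem evalAt_conj (z : ClosedDisc) (f : RealDiscAlgebra) :
    evalAt z.conj f = (starRingEnd ℂ) (evalAt z f) := by
  rw [evalAt_apply, evalAt_apply, f.2.2 z, Complex.conj_conj]

theorem conj_ofReal (x : Set.Icc (-1 : ℝ) 1) :
    (ClosedDisc.ofReal x).conj = ClosedDisc.ofReal x :=
  Subtype.ext (Complex.conj_ofReal _)

theorem evalAt_ofReal (x : Set.Icc (-1 : ℝ) 1) (f : RealDiscAlgebra) :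
    evalAt (ClosedDisc.ofReal x) f = ((evalAt (ClosedDisc.ofReal x) f).re : ℂ) := by
  have h := evalAt_conj (ClosedDisc.ofReal x) f
  rw [conj_ofReal] at h
  exact (Complex.conj_eq_iff_re.1 h.symm).symm

theorem continuous_ofReal : Continuous ClosedDisc.ofReal := by
  unfold ClosedDisc.ofReal
  fun_prop

/-- The units of the real disc algebra are the functions without zeros on the closed disc. -/
theorem isUnit_iff {f : RealDiscAlgebra} : IsUnit f ↔ ∀ z, evalAt z f ≠ 0 := by
  refine ⟨fun h z => (h.map (evalAt z)).ne_zero, fun h => ?_⟩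
  obtain ⟨F, hF, hFf⟩ := f.2.1
  refine IsUnit.of_mul_eq_one
    ⟨⟨fun z => (f.1 z)⁻¹, f.1.continuous.inv₀ h⟩,
      ⟨fun z => (F z)⁻¹, hF.inv fun z hz => ?_, fun z => ?_⟩, fun z => ?_⟩ ?_
  · have := h ⟨z, ball_subset_closedBall hz⟩
    rwa [evalAt_apply, ← hFf] at this
  · simp [hFf]
  · change (f.1 z)⁻¹ = (starRingEnd ℂ) (f.1 z.conj)⁻¹
    rw [map_inv₀, ← f.2.2 z]
  · exact ext_evalAt fun z => mul_inv_cancel₀ (h z)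

theorem isUnit_of_norm_sub_one_lt {f : RealDiscAlgebra} (h : ‖f - 1‖ < 1) : IsUnit f := by
  refine isUnit_iff.2 fun z hz => ?_
  have := (norm_evalAt_le z (f - 1)).trans_lt h
  rw [evalAt_sub, hz, evalAt_one, zero_sub, norm_neg, norm_one] at this
  exact lt_irrefl _ this

/-- The real part of a function in the real disc algebra, restricted to `[-1, 1]`, where it is the
function itself. -/
theorem continuous_re_evalAt_ofReal (f : RealDiscAlgebra) :
    Continuous fun x => (evalAt (ClosedDisc.ofReal x) f).re :=
  Complex.continuous_re.comp ((continuous_evalAt f).comp continuous_ofReal)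

/-- A unit has constant sign on `[-1, 1]`. -/
theorem mul_pos_of_isUnit {u : RealDiscAlgebra} (hu : IsUnit u) (x y : Set.Icc (-1 : ℝ) 1) :
    0 < (evalAt (ClosedDisc.ofReal x) u).re * (evalAt (ClosedDisc.ofReal y) u).re := by
  have hne : ∀ x, (evalAt (ClosedDisc.ofReal x) u).re ≠ 0 := fun x h => by
    apply isUnit_iff.1 hu (ClosedDisc.ofReal x)
    rw [evalAt_ofReal, h, Complex.ofReal_zero]
  have hc := continuous_re_evalAt_ofReal u
  have key : ∀ x y, (evalAt (ClosedDisc.ofReal x) u).re ≤ 0 →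
      0 ≤ (evalAt (ClosedDisc.ofReal y) u).re → False := fun x y hx hy => by
    have : PreconnectedSpace (Set.Icc (-1 : ℝ) 1) :=
      Subtype.preconnectedSpace isPreconnected_Icc
    obtain ⟨w, hw⟩ := mem_range_of_exists_le_of_exists_ge hc ⟨x, hx⟩ ⟨y, hy⟩
    exact hne w hw
  rcases lt_or_gt_of_ne (hne x) with hx | hx <;> rcases lt_or_gt_of_ne (hne y) with hy | hy
  · exact mul_pos_of_neg_of_neg hx hy
  · exact (key x y hx.le hy.le).elim
  · exact (key y x hy.le hx.le).elim
  · exact mul_pos hx hy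

/-! ### Density of real polynomials -/

/-- The coordinate function `z`. -/
def coord : RealDiscAlgebra :=
  ⟨⟨fun z => (z : ℂ), continuous_subtype_val⟩,
    ⟨id, differentiableOn_id, fun _ => rfl⟩, fun _ => (Complex.conj_conj _).symm⟩

/-- A real polynomial as an element of the real disc algebra. -/
noncomputable def ofPoly : ℝ[X] →ₐ[ℝ] RealDiscAlgebra := aeval coord

theorem ofPoly_C (c : ℝ) : ofPoly (C c) = c • (1 : RealDiscAlgebra) := by
  rw [ofPoly, aeval_C, Algebra.algebraMap_eq_smul_one]

theorem evalAt_ofPoly (z : ClosedDisc) (p : ℝ[X]) : evalAt z (ofPoly p) = aeval (z : ℂ) p :=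
  (aeval_algHom_apply (evalAt z) coord p).symm

theorem evalAt_ofReal_ofPoly (x : Set.Icc (-1 : ℝ) 1) (p : ℝ[X]) :
    evalAt (ClosedDisc.ofReal x) (ofPoly p) = ((p.eval (x : ℝ) : ℝ) : ℂ) := by
  rw [evalAt_ofPoly]
  exact aeval_algebraMap_apply_eq_algebraMap_eval (x : ℝ) p

/-- Real polynomials are dense in the real disc algebra: dilate, expand in a power series, and
take the real parts of the coefficients. -/
theorem exists_ofPoly_near (f : RealDiscAlgebra) {ε : ℝ} (hε : 0 < ε) :
    ∃ p : ℝ[X], ‖f - ofPoly p‖ < ε := by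
  obtain ⟨F, hF, hFf⟩ := f.2.1
  -- A dilation `z ↦ f (r z)` close to `f`.
  obtain ⟨r, hr0, hr1, hr⟩ : ∃ r : ℝ, 0 < r ∧ r < 1 ∧
      ∀ z : ClosedDisc, ‖f.1 z - F (r * z)‖ < ε / 2 := by
    have huc : UniformContinuous f.1 :=
      CompactSpace.uniformContinuous_of_continuous f.1.continuous
    obtain ⟨δ, hδ, h⟩ := Metric.uniformContinuous_iff.1 huc (ε / 2) (half_pos hε)
    have hr0 : 0 < 1 - min (δ / 2) (1 / 2) := by
      linarith [min_le_right (δ / 2) (1 / 2 : ℝ)]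
    have hr1 : 0 < min (δ / 2) (1 / 2 : ℝ) := by positivity
    refine ⟨1 - min (δ / 2) (1 / 2), hr0, by linarith, fun z => ?_⟩
    set r : ℝ := 1 - min (δ / 2) (1 / 2) with hr
    have hz : ‖(z : ℂ)‖ ≤ 1 := mem_closedBall_zero_iff.1 z.2
    have hmem : (r : ℂ) * z ∈ closedBall (0 : ℂ) 1 := by
      rw [mem_closedBall_zero_iff, norm_mul, Complex.norm_real, Real.norm_of_nonneg hr0.le]
      exact mul_le_one₀ (by linarith) (norm_nonneg _) hz
    rw [← dist_eq_norm, hFf ⟨_, hmem⟩]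
    refine h ?_
    rw [Subtype.dist_eq, dist_eq_norm, ← one_sub_mul, norm_mul, ← Complex.ofReal_one,
      ← Complex.ofReal_sub, Complex.norm_real, Real.norm_of_nonneg (by linarith)]
    calc (1 - r) * ‖(z : ℂ)‖ ≤ (1 - r) * 1 := by gcongr; linarith
      _ < δ := by linarith [min_le_left (δ / 2) (1 / 2 : ℝ)]
  -- A partial sum of the power series of `F`, close to `F` on the disc of radius `r`.
  obtain ⟨c, n, hcn⟩ : ∃ (c : ℕ → ℂ) (n : ℕ), ∀ z : ClosedDisc,
      ‖F (r * z) - ∑ k ∈ Finset.range n, c k * (z : ℂ) ^ k‖ < ε / 2 := by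
    obtain ⟨s, hrs, hs1⟩ := exists_between hr1
    obtain ⟨t, hst, ht1⟩ := exists_between hs1
    have ht0 : 0 < t := by linarith
    lift s to NNReal using by linarith
    lift t to NNReal using ht0.le
    have hsub : closedBall (0 : ℂ) t ⊆ ball 0 1 := closedBall_subset_ball ht1
    have hps := (hF.mono hsub).hasFPowerSeriesOnBall (by exact_mod_cast ht0)
    have hu := Metric.tendstoUniformlyOn_iff.1
      (hps.tendstoUniformlyOn (r' := s) (by exact_mod_cast hst)) (ε / 2) (half_pos hε)
    obtain ⟨n, hn⟩ := hu.exists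
    refine ⟨fun k => (cauchyPowerSeries F 0 t).coeff k * (r : ℂ) ^ k, n, fun z => ?_⟩
    have hz : ‖(z : ℂ)‖ ≤ 1 := mem_closedBall_zero_iff.1 z.2
    have := hn ((r : ℂ) * z) (by
      rw [mem_ball_zero_iff, norm_mul, Complex.norm_real, Real.norm_of_nonneg hr0.le]
      nlinarith)
    rw [dist_eq_norm, zero_add] at this
    have hsum : (cauchyPowerSeries F 0 t).partialSum n ((r : ℂ) * z) =
        ∑ k ∈ Finset.range n, (cauchyPowerSeries F 0 t).coeff k * (r : ℂ) ^ k * (z : ℂ) ^ k := by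
      refine Finset.sum_congr rfl fun k _ => ?_
      rw [FormalMultilinearSeries.apply_eq_pow_smul_coeff, smul_eq_mul, mul_pow]
      ring
    rwa [hsum] at this
  have hP : ∀ z : ClosedDisc, ‖f.1 z - ∑ k ∈ Finset.range n, c k * (z : ℂ) ^ k‖ < ε := fun z => by
    have := norm_sub_le_norm_sub_add_norm_sub (f.1 z) (F (r * z))
      (∑ k ∈ Finset.range n, c k * (z : ℂ) ^ k)
    linarith [hr z, hcn z]
  refine ⟨∑ k ∈ Finset.range n, C (c k).re * X ^ k, norm_lt_of_forall_evalAt hε fun z => ?_⟩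
  -- Taking real parts of the coefficients averages the polynomial with its reflection.
  have hav : evalAt z (f - ofPoly (∑ k ∈ Finset.range n, C (c k).re * X ^ k)) =
      ((f.1 z - ∑ k ∈ Finset.range n, c k * (z : ℂ) ^ k) +
        (starRingEnd ℂ) (f.1 z.conj - ∑ k ∈ Finset.range n, c k * (z.conj : ℂ) ^ k)) / 2 := by
    rw [evalAt_sub, evalAt_ofPoly, evalAt_apply, map_sub, ← f.2.2 z, map_sum, map_sum]
    simp only [ClosedDisc.conj, map_mul, map_pow, aeval_C, aeval_X, Complex.conj_conj,
      Complex.coe_algebraMap, Complex.re_eq_add_conj]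
    rw [add_sub_assoc', eq_div_iff two_ne_zero, sub_mul, Finset.sum_mul]
    have : ∀ k, (c k + (starRingEnd ℂ) (c k)) / 2 * (z : ℂ) ^ k * 2 =
      c k * (z : ℂ) ^ k + (starRingEnd ℂ) (c k) * (z : ℂ) ^ k := fun k => by ring
    simp only [this, Finset.sum_add_distrib]
    ring
  rw [hav, norm_div, Complex.norm_two, div_lt_iff₀ two_pos]
  refine (norm_add_le _ _).trans_lt ?_
  rw [RCLike.norm_conj]
  linarith [hP z, hP z.conj]

/-! ### Units modulo `g` -/

/-- Some `f + h g` is a unit of the algebra, that is, the class of `f` modulo the ideal generated by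
`g` contains a unit. -/
def UnitModulo (g f : RealDiscAlgebra) : Prop :=
  ∃ h, IsUnit (f + h * g)

theorem UnitModulo.of_isUnit (g : RealDiscAlgebra) {f : RealDiscAlgebra} (hf : IsUnit f) :
    UnitModulo g f := ⟨0, by simpa using hf⟩

variable {g f f' : RealDiscAlgebra}

theorem UnitModulo.mul (h : UnitModulo g f) (h' : UnitModulo g f') : UnitModulo g (f * f') := by
  obtain ⟨k, hk⟩ := h
  obtain ⟨k', hk'⟩ := h'
  refine ⟨f * k' + k * f' + k * k' * g, ?_⟩
  convert hk.mul hk' using 1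
  ring

/-- Multiplying by a unit and adding multiples of `g` does not affect being a unit modulo `g`. -/
theorem UnitModulo.of_eq {v h : RealDiscAlgebra} (hv : IsUnit v) (hf : f' = f * v + h * g) :
    UnitModulo g f ↔ UnitModulo g f' := by
  obtain ⟨v, rfl⟩ := hv
  constructor
  · rintro ⟨k, hk⟩
    refine ⟨k * v - h, ?_⟩
    convert hk.mul v.isUnit using 1
    rw [hf]
    ring
  · rintro ⟨k, hk⟩
    refine ⟨(k + h) * ↑v⁻¹, ?_⟩
    convert hk.mul v⁻¹.isUnit using 1
    rw [hf]
    linear_combination -f * v.mul_inv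

theorem _root_.IsInvertiblePair.mul {R : Type*} [CommRing R] {a b c : R}
    (h : IsInvertiblePair (a, c)) (h' : IsInvertiblePair (b, c)) :
    IsInvertiblePair (a * b, c) :=
  IsCoprime.mul_left h h'

theorem _root_.IsInvertiblePair.of_mul_left {R : Type*} [CommRing R] {a b c : R}
    (h : IsInvertiblePair (a * b, c)) : IsInvertiblePair (a, c) :=
  IsCoprime.of_mul_left_left h

theorem _root_.IsInvertiblePair.of_mul_right {R : Type*} [CommRing R] {a b c : R}
    (h : IsInvertiblePair (a * b, c)) : IsInvertiblePair (b, c) :=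
  IsCoprime.of_mul_left_right h

/-- Functions close to an `f` that is invertible modulo `g` differ from `f`, modulo `g`, by a unit
close to `1`: if `x f + y g = 1`, then `f' ≡ f (1 + x (f' - f))`. -/
theorem eventually_eq_mul_add (h : IsInvertiblePair (f, g)) :
    ∀ᶠ f' in 𝓝 f, ∃ v k : RealDiscAlgebra, ‖v - 1‖ < 1 ∧ f' = f * v + k * g := by
  obtain ⟨x, y, hxy⟩ := h
  have hc : Continuous fun f' : RealDiscAlgebra => ‖x * (f' - f)‖ := by fun_prop
  have h0 : ‖x * (f - f)‖ < 1 := by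
    rw [sub_self, mul_zero, norm_zero]
    exact one_pos
  filter_upwards [hc.continuousAt.eventually_lt_const h0] with f' hf'
  refine ⟨1 + x * (f' - f), (f' - f) * y, by rwa [add_sub_cancel_left], ?_⟩
  linear_combination (f - f') * hxy

/-- Being a unit modulo `g` is constant along connected families of functions that are invertible
modulo `g`. -/
theorem UnitModulo.of_isPreconnected {X : Type*} [TopologicalSpace X] {S : Set X}
    (hS : IsPreconnected S) {F : X → RealDiscAlgebra} (hF : Continuous F)
    (hI : ∀ x ∈ S, IsInvertiblePair (F x, g)) {x y : X} (hx : x ∈ S) (hy : y ∈ S)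
    (h : UnitModulo g (F x)) : UnitModulo g (F y) := by
  refine (hS.induction₂ (fun a b => UnitModulo g (F a) ↔ UnitModulo g (F b)) (fun a ha => ?_)
    (fun _ _ _ _ _ _ => Iff.trans) (fun _ _ _ _ => Iff.symm) hx hy).1 h
  filter_upwards [nhdsWithin_le_nhds (hF.continuousAt.eventually (eventually_eq_mul_add (hI a ha)))]
    with b ⟨v, k, hv, hb⟩
  exact UnitModulo.of_eq (isUnit_of_norm_sub_one_lt hv) hb

/-! ### The complement of the zero set -/

/-- The points of the plane that are not zeros of `g`: those off the closed disc, and those of the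
closed disc where `g` does not vanish. -/
def nonzeroSet (g : RealDiscAlgebra) : Set ℂ :=
  {a | ∀ h : a ∈ closedBall (0 : ℂ) 1, evalAt ⟨a, h⟩ g ≠ 0}

theorem isPreconnected_compl_closedBall : IsPreconnected (closedBall (0 : ℂ) 1)ᶜ := by
  have : (closedBall (0 : ℂ) 1)ᶜ = Complex.exp '' {z | 0 < z.re} := by
    ext w
    simp only [Set.mem_compl_iff, mem_closedBall_zero_iff, not_le, Set.mem_image, Set.mem_ofPred_eq]
    constructor
    · intro hw
      refine ⟨Complex.log w, ?_, Complex.exp_log (norm_pos_iff.1 (by linarith))⟩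
      rw [Complex.log_re]
      exact Real.log_pos hw
    · rintro ⟨z, hz, rfl⟩
      rw [Complex.norm_exp]
      exact Real.one_lt_exp_iff.2 hz
  rw [this]
  exact (convex_halfSpace_re_gt 0).isPreconnected.image _ Complex.continuous_exp.continuousOn

/-- The zeros of a nonzero holomorphic function do not disconnect the open disc, and they do not
contain an open set. -/
theorem isPreconnected_ball_inter_ne_zero {F : ℂ → ℂ} (hF : DifferentiableOn ℂ F (ball 0 1))
    (h0 : ¬ Set.EqOn F 0 (ball 0 1)) :
    IsPreconnected (ball (0 : ℂ) 1 ∩ {z | F z ≠ 0}) ∧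
      ball (0 : ℂ) 1 ⊆ closure (ball (0 : ℂ) 1 ∩ {z | F z ≠ 0}) := by
  have hev := ((hF.analyticOnNhd isOpen_ball).eqOn_zero_or_eventually_ne_zero_of_preconnected
    (convex_ball (0 : ℂ) 1).isPreconnected).resolve_left h0
  have hdisc : IsDiscrete ({z | F z ≠ 0}ᶜ ∩ ball (0 : ℂ) 1) :=
    isDiscrete_of_codiscreteWithin (by rw [compl_compl]; exact hev)
  have hcount : ({z | F z ≠ 0}ᶜ ∩ ball (0 : ℂ) 1).Countable :=
    (HereditarilyLindelofSpace.isLindelof _).countable_of_isDiscrete hdisc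
  have heq : ball (0 : ℂ) 1 ∩ {z | F z ≠ 0} =
      ball (0 : ℂ) 1 ∩ ({z | F z ≠ 0}ᶜ ∩ ball (0 : ℂ) 1)ᶜ := by
    ext z
    simp only [Set.mem_inter_iff, Set.mem_compl_iff]
    tauto
  rw [heq]
  generalize {z | F z ≠ 0}ᶜ ∩ ball (0 : ℂ) 1 = Z at hcount
  refine ⟨?_, ((hcount.dense_compl ℝ).open_subset_closure_inter isOpen_ball)⟩
  -- The open disc is homeomorphic to the plane, where complements of countable sets are connected.
  let e : ℂ → ℂ := fun w => (Homeomorph.unitBall w : ball (0 : ℂ) 1)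
  have he : Function.Injective e := Subtype.val_injective.comp Homeomorph.unitBall.injective
  have hec : Continuous e := continuous_subtype_val.comp Homeomorph.unitBall.continuous
  have hpre := ((hcount.preimage he).isConnected_compl_of_one_lt_rank
    (by simp)).isPreconnected.image e hec.continuousOn
  convert hpre using 1
  ext z
  constructor
  · rintro ⟨hz, hzZ⟩
    refine ⟨Homeomorph.unitBall.symm ⟨z, hz⟩, ?_, ?_⟩
    · simpa [e] using hzZ
    · simp [e]
  · rintro ⟨w, hw, rfl⟩
    exact ⟨(Homeomorph.unitBall w).2, hw⟩

/-- The zero set of a nonzero function of the disc algebra does not separate the plane. -/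
theorem isPreconnected_nonzeroSet (hg : g ≠ 0) : IsPreconnected (nonzeroSet g) := by
  obtain ⟨F, hF, hFg⟩ := g.2.1
  have hmem : ∀ {a : ℂ}, a ∈ closedBall (0 : ℂ) 1 → (a ∈ nonzeroSet g ↔ F a ≠ 0) := fun {a} ha => by
    rw [hFg ⟨a, ha⟩]
    exact ⟨fun h => h ha, fun h _ => h⟩
  have hFc : ContinuousOn F (closedBall 0 1) := by
    rw [continuousOn_iff_continuous_domRestrict]
    exact g.1.continuous.congr fun z => (hFg z).symm
  have hzero : ¬ Set.EqOn F 0 (closedBall 0 1) := fun h =>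
    hg (ext_evalAt fun z => by rw [evalAt_apply, ← hFg, h z.2]; rfl)
  have hcl : closure (ball (0 : ℂ) 1) = closedBall 0 1 := closure_ball _ one_ne_zero
  have h0 : ¬ Set.EqOn F 0 (ball 0 1) := fun h =>
    hzero (h.of_subset_closure hFc continuousOn_const ball_subset_closedBall hcl.ge)
  obtain ⟨hpre, hsub⟩ := isPreconnected_ball_inter_ne_zero hF h0
  have hin : IsPreconnected (nonzeroSet g ∩ closedBall 0 1) := by
    refine hpre.subset_closure (fun z hz => ?_) fun z hz => ?_
    · exact ⟨(hmem (ball_subset_closedBall hz.1)).2 hz.2, ball_subset_closedBall hz.1⟩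
    · exact closure_minimal hsub isClosed_closure (hcl.ge hz.2)
  -- By the maximum principle `g` does not vanish identically on the circle.
  obtain ⟨p, hp, hFp⟩ : ∃ p ∈ sphere (0 : ℂ) 1, F p ≠ 0 := by
    by_contra! h
    refine h0 (Complex.eqOn_of_eqOn_frontier (g := 0) isBounded_ball ⟨hF, hcl ▸ hFc⟩
      diffContOnCl_const fun z hz => h z ?_)
    rwa [frontier_ball _ one_ne_zero] at hz
  have hpg : p ∈ nonzeroSet g := (hmem (sphere_subset_closedBall hp)).2 hFp
  have hout : IsPreconnected (insert p (closedBall (0 : ℂ) 1)ᶜ) := by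
    refine isPreconnected_compl_closedBall.subset_closure (Set.subset_insert _ _)
      (Set.insert_subset ?_ subset_closure)
    rw [closure_compl, interior_closedBall _ one_ne_zero]
    simp [mem_sphere_zero_iff_norm.1 hp]
  have hpin : p ∈ nonzeroSet g ∩ closedBall 0 1 := ⟨hpg, sphere_subset_closedBall hp⟩
  convert hin.union p hpin (Set.mem_insert _ _) hout using 1
  ext z
  by_cases hz : z ∈ closedBall (0 : ℂ) 1
  · have : z = p → z ∈ nonzeroSet g := fun h => h ▸ hpg
    simp only [Set.mem_union, Set.mem_inter_iff, hz, Set.mem_insert_iff, Set.mem_compl_iff]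
    tauto
  · have : z ∈ nonzeroSet g := fun h => (hz h).elim
    simp [hz, this]

/-! ### Linear and quadratic factors invertible modulo `g` -/

theorem isInvertiblePair_of_isUnit (hf : IsUnit f) : IsInvertiblePair (f, g) := by
  obtain ⟨u, rfl⟩ := hf
  exact ⟨↑u⁻¹, 0, by simp⟩

/-- If `y g` is close to `1` modulo the multiples of `f`, then `f` is invertible modulo `g`. -/
theorem isInvertiblePair_of_norm_lt {s y : RealDiscAlgebra} (h : ‖y * g - s * f - 1‖ < 1) :
    IsInvertiblePair (f, g) := by
  obtain ⟨u, hu⟩ := isUnit_of_norm_sub_one_lt h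
  refine ⟨-(s * ↑u⁻¹), y * ↑u⁻¹, ?_⟩
  have := u.mul_inv
  rw [hu] at this
  linear_combination this

/-- A real linear polynomial takes any prescribed value at a nonreal point, with a bound on the
closed disc that is linear in the value. -/
theorem exists_linear_interpolation {a : ℂ} (ha : a.im ≠ 0) :
    ∃ K : ℝ, 0 < K ∧ ∀ w : ℂ, ∃ l : ℝ[X], aeval a l = w ∧ ‖ofPoly l‖ ≤ K * ‖w‖ := by
  refine ⟨‖coord‖ / |a.im| + (1 + |a.re| / |a.im|), by positivity, fun w =>
    ⟨C (w.im / a.im) * X + C (w.re - w.im / a.im * a.re), ?_, ?_⟩⟩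
  · apply Complex.ext
    · simp
    · simp [ha]
  · have h1 : ofPoly (C (w.im / a.im) * X + C (w.re - w.im / a.im * a.re)) =
        (w.im / a.im) • coord + (w.re - w.im / a.im * a.re) • (1 : RealDiscAlgebra) := by
      simp [ofPoly, Algebra.smul_def]
    have hone : ‖(1 : RealDiscAlgebra)‖ ≤ 1 :=
      (ContinuousMap.norm_le _ zero_le_one).2 fun z => by simp
    rw [h1]
    have hre := Complex.abs_re_le_norm w
    have him := Complex.abs_im_le_norm w
    calc _ ≤ ‖(w.im / a.im) • coord‖ + ‖(w.re - w.im / a.im * a.re) • (1 : RealDiscAlgebra)‖ :=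
          norm_add_le _ _
      _ ≤ |w.im| / |a.im| * ‖coord‖ + (|w.re| + |w.im| / |a.im| * |a.re|) * 1 := by
          rw [norm_smul, norm_smul, Real.norm_eq_abs, Real.norm_eq_abs, abs_div]
          gcongr
          refine (abs_sub _ _).trans_eq ?_
          rw [abs_mul, abs_div]
      _ ≤ ‖w‖ / |a.im| * ‖coord‖ + (‖w‖ + ‖w‖ / |a.im| * |a.re|) * 1 := by gcongr
      _ = _ := by ring

/-- The monic real quadratic polynomial with roots `a` and its complex conjugate. -/
noncomputable def conjQuadratic (a : ℂ) : ℝ[X] := X ^ 2 - C (2 * a.re) * X + C (‖a‖ ^ 2)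

theorem aeval_conjQuadratic (a z : ℂ) :
    aeval z (conjQuadratic a) = (z - a) * (z - (starRingEnd ℂ) a) := by
  have h1 : ((2 * a.re : ℝ) : ℂ) = a + (starRingEnd ℂ) a := (Complex.add_conj a).symm
  have h2 : ((‖a‖ ^ 2 : ℝ) : ℂ) = a * (starRingEnd ℂ) a := by
    rw [Complex.mul_conj']; norm_cast
  have h3 : aeval z (conjQuadratic a) = z ^ 2 - ((2 * a.re : ℝ) : ℂ) * z + ((‖a‖ ^ 2 : ℝ) : ℂ) := by
    simp [conjQuadratic]
  rw [h3, h1, h2]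
  ring

theorem conjQuadratic_ofReal (a : ℝ) : conjQuadratic a = (X - C a) * (X - C a) := by
  rw [conjQuadratic, Complex.ofReal_re, Complex.norm_real, Real.norm_eq_abs, sq_abs, C_mul, C_pow]
  simp only [map_ofNat]
  ring

theorem eval_conjQuadratic_pos {a : ℂ} (ha : a.im ≠ 0) (x : ℝ) : 0 < (conjQuadratic a).eval x := by
  have : (conjQuadratic a).eval x = (x - a.re) ^ 2 + a.im ^ 2 := by
    simp only [conjQuadratic, eval_add, eval_sub, eval_mul, eval_pow, eval_X, eval_C,
      Complex.sq_norm, Complex.normSq_apply]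
    ring
  rw [this]
  positivity

theorem natDegree_conjQuadratic (a : ℂ) : (conjQuadratic a).natDegree = 2 := by
  rw [conjQuadratic]
  compute_degree!

theorem isUnit_ofPoly_X_sub_C {a : ℝ} (ha : (a : ℂ) ∉ closedBall (0 : ℂ) 1) :
    IsUnit (ofPoly (X - C a)) := by
  refine isUnit_iff.2 fun z hz => ha ?_
  rw [evalAt_ofPoly] at hz
  have : (z : ℂ) = a := by simpa [sub_eq_zero] using hz
  exact this ▸ z.2

theorem isUnit_ofPoly_conjQuadratic {a : ℂ} (ha : a ∉ closedBall (0 : ℂ) 1) :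
    IsUnit (ofPoly (conjQuadratic a)) := by
  refine isUnit_iff.2 fun z hz => ha ?_
  rw [evalAt_ofPoly, aeval_conjQuadratic, mul_eq_zero, sub_eq_zero, sub_eq_zero] at hz
  have hz1 := z.2
  rw [mem_closedBall_zero_iff] at hz1 ⊢
  rcases hz with hz | hz
  · rwa [← hz]
  · rwa [← RCLike.norm_conj, ← hz]

/-- `X - a` is invertible modulo `g` if `g` does not vanish at the real number `a`. On the boundary
of the disc `g - g(a)` need not be divisible by `X - a`, but a polynomial close to `g` is. -/
theorem isInvertiblePair_X_sub_C {a : ℝ} (ha : (a : ℂ) ∈ nonzeroSet g) :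
    IsInvertiblePair (ofPoly (X - C a), g) := by
  by_cases hmem : (a : ℂ) ∈ closedBall (0 : ℂ) 1
  swap
  · exact isInvertiblePair_of_isUnit (isUnit_ofPoly_X_sub_C hmem)
  have hga := ha hmem
  have hpos : 0 < ‖evalAt ⟨a, hmem⟩ g‖ := norm_pos_iff.2 hga
  obtain ⟨q, hq⟩ := exists_ofPoly_near g (half_pos hpos)
  have hqa : ‖evalAt ⟨a, hmem⟩ (g - ofPoly q)‖ < ‖evalAt ⟨a, hmem⟩ g‖ / 2 :=
    (norm_evalAt_le _ _).trans_lt hq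
  have hval : evalAt ⟨a, hmem⟩ (ofPoly q) = ((q.eval a : ℝ) : ℂ) := by
    rw [evalAt_ofPoly]
    exact aeval_algebraMap_apply_eq_algebraMap_eval a q
  rw [evalAt_sub, hval] at hqa
  have hq2 : ‖evalAt ⟨a, hmem⟩ g‖ / 2 < |q.eval a| := by
    have := norm_sub_norm_le (evalAt ⟨a, hmem⟩ g) ((q.eval a : ℝ) : ℂ)
    rw [Complex.norm_real, Real.norm_eq_abs] at this
    linarith
  have hq0 : q.eval a ≠ 0 := abs_pos.1 (by linarith)
  obtain ⟨s, hs⟩ := X_sub_C_dvd_sub_C_eval (a := a) (p := q)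
  refine isInvertiblePair_of_norm_lt (y := (q.eval a)⁻¹ • 1) (s := (q.eval a)⁻¹ • ofPoly s) ?_
  have h1 : ofPoly q = ofPoly (X - C a) * ofPoly s + (q.eval a) • (1 : RealDiscAlgebra) := by
    have := congrArg ofPoly (sub_eq_iff_eq_add.1 hs)
    rw [this, map_add, map_mul, ofPoly_C]
  have h2 : ((q.eval a)⁻¹ • (1 : RealDiscAlgebra)) * g -
      ((q.eval a)⁻¹ • ofPoly s) * ofPoly (X - C a) - 1 = (q.eval a)⁻¹ • (g - ofPoly q) := by
    rw [h1, smul_mul_assoc, smul_mul_assoc, one_mul, smul_sub, smul_add, smul_smul,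
      inv_mul_cancel₀ hq0, one_smul, mul_comm (ofPoly s)]
    abel
  rw [h2, norm_smul, norm_inv, Real.norm_eq_abs, inv_mul_lt_one₀ (by linarith)]
  linarith

/-- The quadratic polynomial with roots `a` and its conjugate is invertible modulo `g` if `g` does
not vanish at `a`. -/
theorem isInvertiblePair_conjQuadratic {a : ℂ} (ha : a ∈ nonzeroSet g) :
    IsInvertiblePair (ofPoly (conjQuadratic a), g) := by
  by_cases hmem : a ∈ closedBall (0 : ℂ) 1
  swap
  · exact isInvertiblePair_of_isUnit (isUnit_ofPoly_conjQuadratic hmem)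
  by_cases him : a.im = 0
  · obtain ⟨r, rfl⟩ : ∃ r : ℝ, (r : ℂ) = a := ⟨a.re, Complex.ext rfl him.symm⟩
    rw [conjQuadratic_ofReal, map_mul]
    exact (isInvertiblePair_X_sub_C ha).mul (isInvertiblePair_X_sub_C ha)
  obtain ⟨K, hK, hint⟩ := exists_linear_interpolation him
  -- `y g - 1` vanishes at `a`, so it is close to polynomials divisible by the quadratic.
  obtain ⟨y, hy, -⟩ := hint (evalAt ⟨a, hmem⟩ g)⁻¹
  obtain ⟨q, hq⟩ := exists_ofPoly_near (ofPoly y * g - 1) (ε := 1 / (1 + K)) (by positivity)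
  obtain ⟨l, hl, hlK⟩ := hint (aeval a q)
  have hqa : ‖aeval a q‖ ≤ ‖ofPoly y * g - 1 - ofPoly q‖ := by
    have := norm_evalAt_le ⟨a, hmem⟩ (ofPoly y * g - 1 - ofPoly q)
    rwa [evalAt_sub, evalAt_sub, evalAt_mul, evalAt_ofPoly, evalAt_ofPoly, hy,
      inv_mul_cancel₀ (ha hmem), evalAt_one, sub_self, zero_sub, norm_neg] at this
  obtain ⟨s, hs⟩ : conjQuadratic a ∣ q - l :=
    quadratic_dvd_of_aeval_eq_zero_im_ne_zero _ (by rw [map_sub, hl, sub_self]) him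
  refine isInvertiblePair_of_norm_lt (y := ofPoly y) (s := ofPoly s) ?_
  have h1 : ofPoly y * g - ofPoly s * ofPoly (conjQuadratic a) - 1 =
      (ofPoly y * g - 1 - ofPoly q) + ofPoly l := by
    rw [← map_mul, mul_comm s, ← hs, map_sub]
    ring
  rw [h1]
  calc _ ≤ ‖ofPoly y * g - 1 - ofPoly q‖ + K * ‖ofPoly y * g - 1 - ofPoly q‖ :=
        (norm_add_le _ _).trans (by gcongr; exact hlK.trans (by gcongr))
    _ = (1 + K) * ‖ofPoly y * g - 1 - ofPoly q‖ := by ring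
    _ < 1 := by rwa [lt_div_iff₀' (by positivity)] at hq

/-! ### Moving roots -/

theorem continuous_ofPoly_X_sub_C : Continuous fun a : ℝ => ofPoly (X - C a) := by
  have : (fun a : ℝ => ofPoly (X - C a)) = fun a => coord - a • 1 := by
    ext1 a
    simp [ofPoly, Algebra.algebraMap_eq_smul_one]
  rw [this]
  fun_prop

theorem continuous_ofPoly_conjQuadratic : Continuous fun a : ℂ => ofPoly (conjQuadratic a) := by
  have : (fun a : ℂ => ofPoly (conjQuadratic a)) =
      fun a => coord ^ 2 - (2 * a.re) • coord + (‖a‖ ^ 2) • 1 := by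
    ext1 a
    simp only [conjQuadratic, ofPoly, map_add, map_sub, map_mul, map_pow, aeval_X, aeval_C,
      Algebra.smul_def, mul_one]
  rw [this]
  fun_prop

/-- A pair of conjugate roots can be moved out of the disc past the zeros of `g`. -/
theorem unitModulo_conjQuadratic (hg : g ≠ 0) {a : ℂ} (ha : a ∈ nonzeroSet g) :
    UnitModulo g (ofPoly (conjQuadratic a)) := by
  have h2 : (2 : ℂ) ∉ closedBall (0 : ℂ) 1 := by simp
  exact UnitModulo.of_isPreconnected (isPreconnected_nonzeroSet hg) continuous_ofPoly_conjQuadratic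
    (fun _ => isInvertiblePair_conjQuadratic) (fun h => (h2 h).elim) ha
    (.of_isUnit g (isUnit_ofPoly_conjQuadratic h2))

/-- A real root can be moved out of the disc along a ray of the real line without zeros of `g`. -/
theorem unitModulo_X_sub_C {S : Set ℝ} (hS : IsPreconnected S)
    (hSg : ∀ x ∈ S, (x : ℂ) ∈ nonzeroSet g) {b : ℝ} (hb : b ∈ S)
    (hb1 : (b : ℂ) ∉ closedBall (0 : ℂ) 1) {a : ℝ} (ha : a ∈ S) :
    UnitModulo g (ofPoly (X - C a)) :=
  UnitModulo.of_isPreconnected hS continuous_ofPoly_X_sub_C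
    (fun x hx => isInvertiblePair_X_sub_C (hSg x hx)) hb ha
    (.of_isUnit g (isUnit_ofPoly_X_sub_C hb1))

/-- Two real roots with no zero of `g` between them can be moved together, and then out of the
disc as a conjugate pair. -/
theorem unitModulo_X_sub_C_mul (hg : g ≠ 0) {a b : ℝ} (hab : a ≤ b)
    (hSg : ∀ x ∈ Set.Icc a b, (x : ℂ) ∈ nonzeroSet g) :
    UnitModulo g (ofPoly ((X - C a) * (X - C b))) := by
  have ha : a ∈ Set.Icc a b := Set.left_mem_Icc.2 hab
  refine UnitModulo.of_isPreconnected (F := fun x => ofPoly ((X - C a) * (X - C x)))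
    isPreconnected_Icc ?_ (fun x hx => ?_) ha (Set.right_mem_Icc.2 hab) ?_
  · simp only [map_mul]
    exact continuous_const.mul continuous_ofPoly_X_sub_C
  · rw [map_mul]
    exact (isInvertiblePair_X_sub_C (hSg a ha)).mul (isInvertiblePair_X_sub_C (hSg x hx))
  · rw [← conjQuadratic_ofReal]
    exact unitModulo_conjQuadratic hg (hSg a ha)

/-! ### Real polynomials of constant sign on the real zeros of `g` -/

theorem mem_closedBall_ofReal {x : ℝ} :
    (x : ℂ) ∈ closedBall (0 : ℂ) 1 ↔ x ∈ Set.Icc (-1 : ℝ) 1 := by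
  rw [mem_closedBall_zero_iff, Complex.norm_real, Real.norm_eq_abs, abs_le, Set.mem_Icc]

/-- A root of a polynomial that is invertible modulo `g` is not a zero of `g`. -/
theorem mem_nonzeroSet_of_aeval_eq_zero {p : ℝ[X]} (hp : IsInvertiblePair (ofPoly p, g)) {a : ℂ}
    (ha : aeval a p = 0) : a ∈ nonzeroSet g := by
  intro hmem hga
  obtain ⟨x, y, hxy⟩ := hp
  have := congrArg (evalAt ⟨a, hmem⟩) hxy
  simp only [evalAt_add, evalAt_mul, evalAt_one, evalAt_ofPoly, ha, hga, mul_zero, add_zero] at this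
  exact zero_ne_one this

/-- A real polynomial without real roots on an interval has constant sign there. -/
theorem eval_mul_pos_of_forall_ne_zero {p : ℝ[X]} {S : Set ℝ} (hS : IsPreconnected S)
    (h : ∀ x ∈ S, p.eval x ≠ 0) {x y : ℝ} (hx : x ∈ S) (hy : y ∈ S) :
    0 < p.eval x * p.eval y := by
  have key : ∀ x ∈ S, ∀ y ∈ S, p.eval x ≤ 0 → 0 ≤ p.eval y → False := fun x hx y hy h1 h2 => by
    obtain ⟨w, hw, hw0⟩ := hS.intermediate_value hx hy p.continuousOn ⟨h1, h2⟩
    exact h w hw hw0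
  rcases lt_or_gt_of_ne (h x hx) with h1 | h1 <;> rcases lt_or_gt_of_ne (h y hy) with h2 | h2
  · exact mul_pos_of_neg_of_neg h1 h2
  · exact (key x hx y hy h1.le h2.le).elim
  · exact (key y hy x hx h2.le h1.le).elim
  · exact mul_pos h1 h2

/-- A nonzero real polynomial with a real root has a smallest one. -/
theorem exists_smallest_root {p : ℝ[X]} (hp : p ≠ 0) (h : ∃ a, p.eval a = 0) :
    ∃ a, p.eval a = 0 ∧ ∀ x < a, p.eval x ≠ 0 := by
  obtain ⟨a, ha⟩ := h
  have hne : p.roots.toFinset.Nonempty := ⟨a, by simpa [hp] using ha⟩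
  refine ⟨p.roots.toFinset.min' hne, ?_, fun x hx h => ?_⟩
  · simpa [hp] using p.roots.toFinset.min'_mem hne
  · exact (p.roots.toFinset.min'_le x (by simpa [hp] using h)).not_gt hx

/-- The condition that `p` has the same nonzero sign at all zeros of `g` in `[-1, 1]`. -/
def ConstantSign (g : RealDiscAlgebra) (p : ℝ[X]) : Prop :=
  ∀ x y : ℝ, (x : ℂ) ∉ nonzeroSet g → (y : ℂ) ∉ nonzeroSet g → 0 < p.eval x * p.eval y

theorem ConstantSign.of_mul_left {q p : ℝ[X]} (h : ConstantSign g (q * p))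
    (hq : ConstantSign g q) : ConstantSign g p := fun x y hx hy => by
  have h1 := h x y hx hy
  rw [eval_mul, eval_mul, mul_mul_mul_comm] at h1
  exact (pos_iff_pos_of_mul_pos h1).1 (hq x y hx hy)

/-- A polynomial that is invertible modulo `g` and has constant sign on the real zeros of `g` is a
unit modulo `g`. Conjugate pairs of roots, real roots with no zero of `g` on one side, and the two
smallest real roots are removed in turn. If the smallest real root has zeros of `g` on both sides,
no zero of `g` lies between it and the next root, for the sign would change there. -/
theorem unitModulo_ofPoly (hg : g ≠ 0) (n : ℕ) (p : ℝ[X]) (hn : p.natDegree < n)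
    (hp : IsInvertiblePair (ofPoly p, g)) (hsign : ConstantSign g p) :
    UnitModulo g (ofPoly p) := by
  induction n generalizing p with
  | zero => simp at hn
  | succ n ih =>
  by_cases hp0 : p = 0
  · -- Then `g` itself is a unit.
    subst hp0
    obtain ⟨x, y, hxy⟩ := hp
    refine ⟨y, ?_⟩
    simp only [map_zero, mul_zero, zero_add] at hxy ⊢
    rw [hxy]
    exact isUnit_one
  -- A factor that is a unit modulo `g` and of constant sign can be removed.
  have step : ∀ q s : ℝ[X], p = q * s → 0 < q.natDegree → UnitModulo g (ofPoly q) →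
      ConstantSign g q → UnitModulo g (ofPoly p) := by
    rintro q s rfl hq hqu hqs
    rw [natDegree_mul (left_ne_zero_of_mul hp0) (right_ne_zero_of_mul hp0)] at hn
    rw [map_mul] at hp ⊢
    exact hqu.mul (ih s (by omega) hp.of_mul_right (hsign.of_mul_left hqs))
  by_cases hdeg : p.natDegree = 0
  · obtain ⟨c, rfl⟩ := natDegree_eq_zero.1 hdeg
    have hc : c ≠ 0 := fun h => hp0 (by rw [h, C_0])
    exact .of_isUnit g (((isUnit_C.2 hc.isUnit)).map ofPoly)
  obtain ⟨z, hz⟩ := IsAlgClosed.exists_aeval_eq_zero ℂ p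
    (fun h => hdeg (natDegree_eq_of_degree_eq_some h))
  by_cases him : z.im = 0
  swap
  · obtain ⟨s, hs⟩ : conjQuadratic z ∣ p := quadratic_dvd_of_aeval_eq_zero_im_ne_zero p hz him
    refine step _ s hs (by rw [natDegree_conjQuadratic]; exact two_pos)
      (unitModulo_conjQuadratic hg (mem_nonzeroSet_of_aeval_eq_zero hp hz)) fun x y _ _ => ?_
    exact mul_pos (eval_conjQuadratic_pos him x) (eval_conjQuadratic_pos him y)
  have hreal : ∀ {x : ℝ}, p.eval x = 0 → (x : ℂ) ∈ nonzeroSet g := fun {x} hx =>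
    mem_nonzeroSet_of_aeval_eq_zero hp <| by
      rw [← Complex.coe_algebraMap, aeval_algebraMap_apply_eq_algebraMap_eval, hx, map_zero]
  obtain ⟨a, ha, hmin⟩ := exists_smallest_root hp0 ⟨z.re, by
    have hzr : ((z.re : ℝ) : ℂ) = z := Complex.ext rfl him.symm
    rw [← hzr, ← Complex.coe_algebraMap, aeval_algebraMap_apply_eq_algebraMap_eval] at hz
    exact Complex.ofReal_eq_zero.1 hz⟩
  obtain ⟨s, hs⟩ := dvd_iff_isRoot.2 ha
  by_cases hleft : ∀ x ≤ a, (x : ℂ) ∈ nonzeroSet g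
  · refine step _ s hs (by simp) (unitModulo_X_sub_C isPreconnected_Iic hleft (min_le_left a (-2))
      (fun h => ?_) Set.self_mem_Iic) fun x y hx hy => ?_
    · linarith [(mem_closedBall_ofReal.1 h).1, min_le_right a (-2)]
    · have hx' : a < x := not_le.1 fun h => hx (hleft x h)
      have hy' : a < y := not_le.1 fun h => hy (hleft y h)
      simpa using mul_pos (sub_pos.2 hx') (sub_pos.2 hy')
  by_cases hright : ∀ x, a ≤ x → (x : ℂ) ∈ nonzeroSet g
  · refine step _ s hs (by simp) (unitModulo_X_sub_C isPreconnected_Ici hright (le_max_left a 2)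
      (fun h => ?_) Set.self_mem_Ici) fun x y hx hy => ?_
    · linarith [(mem_closedBall_ofReal.1 h).2, le_max_right a 2]
    · have hx' : x < a := not_le.1 fun h => hx (hright x h)
      have hy' : y < a := not_le.1 fun h => hy (hright y h)
      simpa using mul_pos_of_neg_of_neg (sub_neg.2 hx') (sub_neg.2 hy')
  push Not at hleft hright
  obtain ⟨x₀, hx₀a, hx₀⟩ := hleft
  obtain ⟨x₁, hx₁a, hx₁⟩ := hright
  have hx₀a : x₀ < a := hx₀a.lt_of_ne fun h => hx₀ (hreal (h ▸ ha))
  have hx₁a : a < x₁ := hx₁a.lt_of_ne fun h => hx₁ (hreal (h ▸ ha))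
  -- Between zeros of `g` on different sides of `a` the cofactor `s` has to change sign.
  have hflip : ∀ y, a < y → (y : ℂ) ∉ nonzeroSet g → s.eval x₀ * s.eval y < 0 := fun y hy hyg => by
    have h := hsign x₀ y hx₀ hyg
    rw [hs, eval_mul, eval_mul, mul_mul_mul_comm] at h
    refine (neg_iff_neg_of_mul_pos h).1 ?_
    simpa using mul_neg_of_neg_of_pos (sub_neg.2 hx₀a) (sub_pos.2 hy)
  have hs0 : s ≠ 0 := fun h => hp0 (by rw [hs, h, mul_zero])
  obtain ⟨b, hb, hbmin⟩ := exists_smallest_root hs0 <| by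
    by_contra! h
    exact (hflip x₁ hx₁a hx₁).not_gt (eval_mul_pos_of_forall_ne_zero isPreconnected_univ
      (fun x _ => h x) (Set.mem_univ _) (Set.mem_univ _))
  have hpb : p.eval b = 0 := by rw [hs, eval_mul, hb, mul_zero]
  have hab : a ≤ b := not_lt.1 fun h => hmin b h hpb
  have hmid : ∀ y ∈ Set.Icc a b, (y : ℂ) ∈ nonzeroSet g := by
    intro y hy
    by_contra hyg
    have hya : a < y := hy.1.lt_of_ne fun h => hyg (hreal (h ▸ ha))
    have hyb : y < b := hy.2.lt_of_ne fun h => hyg (hreal (h ▸ hpb))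
    exact (hflip y hya hyg).not_gt (eval_mul_pos_of_forall_ne_zero isPreconnected_Iio hbmin
      (hx₀a.trans_le hab) hyb)
  obtain ⟨t, ht⟩ := dvd_iff_isRoot.2 hb
  have hpos : ∀ x : ℝ, (x : ℂ) ∉ nonzeroSet g → 0 < ((X - C a) * (X - C b)).eval x := by
    intro x hx
    simp only [eval_mul, eval_sub, eval_X, eval_C]
    rcases lt_or_ge x a with h | h
    · exact mul_pos_of_neg_of_neg (sub_neg.2 h) (sub_neg.2 (h.trans_le hab))
    · have h' : b < x := not_le.1 fun h' => hx (hmid x ⟨h, h'⟩)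
      exact mul_pos (sub_pos.2 (hab.trans_lt h')) (sub_pos.2 h')
  refine step ((X - C a) * (X - C b)) t (by rw [mul_assoc, ← ht, ← hs]) ?_
    (unitModulo_X_sub_C_mul hg hab hmid) fun x y hx hy => mul_pos (hpos x hx) (hpos y hy)
  rw [natDegree_mul (X_sub_C_ne_zero a) (X_sub_C_ne_zero b)]
  simp

/-- An element invertible modulo `g`, of constant sign on the zeros of `g` in `[-1, 1]`, is a unit
modulo `g`. -/
theorem unitModulo_of_mul_pos (hf : IsInvertiblePair (f, g))
    (hsign : ∀ x y : Set.Icc (-1 : ℝ) 1, evalAt (ClosedDisc.ofReal x) g = 0 →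
      evalAt (ClosedDisc.ofReal y) g = 0 →
      0 < (evalAt (ClosedDisc.ofReal x) f).re * (evalAt (ClosedDisc.ofReal y) f).re) :
    UnitModulo g f := by
  rcases eq_or_ne g 0 with rfl | hg
  · obtain ⟨x, y, hxy⟩ := hf
    exact .of_isUnit 0 (IsUnit.of_mul_eq_one_right x (by simpa using hxy))
  -- Replace `f` by a polynomial `p = f v + k g` with `v` close to `1`.
  obtain ⟨δ, hδ, hnear⟩ := Metric.eventually_nhds_iff.1 (eventually_eq_mul_add hf)
  obtain ⟨p, hp⟩ := exists_ofPoly_near f hδ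
  obtain ⟨v, k, hv, hpv⟩ := hnear (y := ofPoly p) (by rwa [dist_comm, dist_eq_norm])
  have hvu := isUnit_of_norm_sub_one_lt hv
  refine (UnitModulo.of_eq hvu hpv).2 (unitModulo_ofPoly hg _ p (Nat.lt_succ_self _) ?_ ?_)
  · have : IsInvertiblePair (f * v, g) := hf.mul (isInvertiblePair_of_isUnit hvu)
    rw [hpv]
    exact IsCoprime.add_mul_right_left this k
  · intro x y hx hy
    simp only [nonzeroSet, Set.mem_ofPred_eq, not_forall, not_not] at hx hy
    obtain ⟨hx1, hx⟩ := hx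
    obtain ⟨hy1, hy⟩ := hy
    have hval : ∀ (w : ℝ) (hw : (w : ℂ) ∈ closedBall (0 : ℂ) 1), evalAt ⟨w, hw⟩ g = 0 →
        p.eval w = (evalAt (ClosedDisc.ofReal ⟨w, mem_closedBall_ofReal.1 hw⟩) f).re *
          (evalAt (ClosedDisc.ofReal ⟨w, mem_closedBall_ofReal.1 hw⟩) v).re := fun w hw hg0 => by
      have h1 := evalAt_ofReal_ofPoly ⟨w, mem_closedBall_ofReal.1 hw⟩ p
      have h2 : evalAt (ClosedDisc.ofReal ⟨w, mem_closedBall_ofReal.1 hw⟩) g = 0 := hg0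
      rw [hpv, evalAt_add, evalAt_mul, evalAt_mul, h2, mul_zero, add_zero, evalAt_ofReal, evalAt_ofReal _ v,
        ← Complex.ofReal_mul] at h1
      exact (Complex.ofReal_injective h1).symm
    rw [hval x hx1 hx, hval y hy1 hy, mul_mul_mul_comm]
    exact mul_pos (hsign _ _ hx hy) (mul_pos_of_isUnit hvu _ _)

end RealDiscAlgebra

/-! ### Simultaneous stabilization -/

open RealDiscAlgebra in
theorem theorem0p1 (f₁ g₁ f₂ g₂ : RealDiscAlgebra)
    (h₁ : IsInvertiblePair (f₁, g₁)) (h₂ : IsInvertiblePair (f₂, g₂)) :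
    SimultaneouslyStabilizable (f₁, g₁) (f₂, g₂) ↔ SignLinked (f₁, g₁) (f₂, g₂) := by
  constructor
  · rintro ⟨α, β, hu₁, hu₂⟩ x y s t - - hfx hgx hfy hgy
    -- The factor `λ` is the quotient of the two units.
    have key : ∀ (w : Set.Icc (-1 : ℝ) 1) (r : ℝ),
        f₂.1 (ClosedDisc.ofReal w) = r * f₁.1 (ClosedDisc.ofReal w) →
        g₂.1 (ClosedDisc.ofReal w) = r * g₁.1 (ClosedDisc.ofReal w) →
        (evalAt (ClosedDisc.ofReal w) (α * f₂ + β * g₂)).re =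
          r * (evalAt (ClosedDisc.ofReal w) (α * f₁ + β * g₁)).re := fun w r hf hg => by
      rw [← Complex.re_ofReal_mul]
      congr 1
      simp only [evalAt_add, evalAt_mul]
      rw [evalAt_apply _ f₂, evalAt_apply _ g₂, hf, hg, evalAt_apply _ f₁, evalAt_apply _ g₁]
      ring
    have hp₁ := mul_pos_of_isUnit hu₁ x y
    have hp₂ := mul_pos_of_isUnit hu₂ x y
    simp only [key x s hfx hgx, key y t hfy hgy] at hp₂
    rw [mul_mul_mul_comm] at hp₂
    have hst : 0 < s * t := pos_of_mul_pos_left hp₂ hp₁.le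
    rcases mul_pos_iff.1 hst with ⟨hs, ht⟩ | ⟨hs, ht⟩
    · rw [sign_pos hs, sign_pos ht]
    · rw [sign_neg hs, sign_neg ht]
  · intro hlink
    obtain ⟨a, b, hab⟩ := h₁
    obtain ⟨c, d, hcd⟩ := h₂
    simp only at hab hcd
    -- `(α, β) = (a + h g₁, b - h f₁)` are the solutions of `α f₁ + β g₁ = 1`.
    have hF : IsInvertiblePair (a * f₂ + b * g₂, f₂ * g₁ - f₁ * g₂) := by
      refine ⟨c * f₁ + d * g₁, c * b - d * a, ?_⟩
      linear_combination (c * f₂ + d * g₂) * hab + hcd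
    have hlam : ∀ x : Set.Icc (-1 : ℝ) 1,
        evalAt (ClosedDisc.ofReal x) (f₂ * g₁ - f₁ * g₂) = 0 →
        f₂.1 (ClosedDisc.ofReal x) = ((evalAt (ClosedDisc.ofReal x) (a * f₂ + b * g₂)).re : ℝ) *
            f₁.1 (ClosedDisc.ofReal x) ∧
          g₂.1 (ClosedDisc.ofReal x) = ((evalAt (ClosedDisc.ofReal x) (a * f₂ + b * g₂)).re : ℝ) *
            g₁.1 (ClosedDisc.ofReal x) := fun x hx => by
      have hab' := congrArg (evalAt (ClosedDisc.ofReal x)) hab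
      rw [← evalAt_ofReal]
      simp only [evalAt_add, evalAt_mul, evalAt_sub, evalAt_one, ← evalAt_apply] at hx hab' ⊢
      constructor
      · linear_combination -evalAt (ClosedDisc.ofReal x) f₂ * hab' +
          evalAt (ClosedDisc.ofReal x) b * hx
      · linear_combination -evalAt (ClosedDisc.ofReal x) g₂ * hab' -
          evalAt (ClosedDisc.ofReal x) a * hx
    obtain ⟨h, hu⟩ := unitModulo_of_mul_pos hF fun x y hx hy => by
      have hD : ∀ w : Set.Icc (-1 : ℝ) 1,
          evalAt (ClosedDisc.ofReal w) (f₂ * g₁ - f₁ * g₂) = 0 →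
          (f₁ * g₂ - f₂ * g₁).1 (ClosedDisc.ofReal w) = 0 := fun w hw => by
        rw [evalAt_sub, evalAt_mul, evalAt_mul] at hw
        rw [← evalAt_apply, evalAt_sub, evalAt_mul, evalAt_mul]
        linear_combination -hw
      have hs := hlink x y _ _ (hD x hx) (hD y hy) (hlam x hx).1 (hlam x hx).2 (hlam y hy).1
        (hlam y hy).2
      have hne : (evalAt (ClosedDisc.ofReal x) (a * f₂ + b * g₂)).re ≠ 0 := fun h0 => by
        obtain ⟨h1, h2⟩ := hlam x hx
        have := congrArg (evalAt (ClosedDisc.ofReal x)) hcd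
        simp only [h0, Complex.ofReal_zero, zero_mul] at h1 h2
        rw [evalAt_add, evalAt_mul, evalAt_mul, evalAt_apply _ f₂, evalAt_apply _ g₂, h1, h2, mul_zero,
          mul_zero, add_zero, evalAt_one] at this
        exact zero_ne_one this
      rcases lt_or_gt_of_ne hne with h0 | h0
      · rw [sign_neg h0] at hs
        exact mul_pos_of_neg_of_neg h0 (sign_eq_neg_one_iff.1 hs.symm)
      · rw [sign_pos h0] at hs
        exact mul_pos h0 (sign_eq_one_iff.1 hs.symm)
    refine ⟨a + h * g₁, b - h * f₁, ?_, ?_⟩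
    · convert isUnit_one using 1
      linear_combination hab
    · convert hu using 1
      ring
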